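/- All digraphs are finite, without loops or multiple arcs. $K_n^\ast$ denotes the complete symmetric digraph on $n$ vertices (all arcs $(u,v)$ with $u\neq v$). For a positive integer $m$ let $\mathbb{Z}_m^\ast=\mathbb{Z}_m\setminus\{0\}$, and for $S\subseteq\mathbb{Z}_m^\ast$ let $\vec{C}(m;S)$ be the directed circulant with vertex set $\mathbb{Z}_m$ and arc set $\{(i,i+d): i\in\mathbb{Z}_m,\ d\in S\}$. For a digraph $D$ and a set $A$ of arcs on its vertices, $D-A$ and $D+A$ denote the digraphs obtained from $D$ by deleting, respectively adding, the arcs in $A$. A decomposition of a digraph $D$ is a collection of subdigraphs of $D$ whose arc sets partition the arc set of $D$; it is resolvable if it can be partitioned into resolution classes, that is, into subcollections each of which has members whose vertex sets partition the vertex set of $D$. A (resolvable) directed $m$-cycle decomposition is a (resolvable) decomposition all of whose members are directed cycles of length $m$. **Proposition.** Let $m\ge 15$ be an odd integer with $3\mid m$, and let $k=\frac{m-1}{2}$. Define $s_1,t_1\in\mathbb{Z}_m$ as the residues modulo $m$ of the following integers: - if $k\equiv 0\pmod 4$: $s_1=\frac{k}{2}$, $t_1=\frac{3k}{4}$; - if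 $k\equiv 1\pmod 4$: $s_1=\frac{3k+1}{2}$, $t_1=\frac{k-1}{4}$; - if $k\equiv 2\pmod 4$: $s_1=\frac{k}{2}$, $t_1=\frac{7k+2}{4}$; - if $k\equiv 3\pmod 4$: $s_1=\frac{3k+1}{2}$, $t_1=\frac{5k+1}{4}$. For $i=1,2$ let $s_{1+i}=s_1+2i$ and $t_{1+i}=t_1+i$ in $\mathbb{Z}_m$. Define the arcs $$b_1^X=(t_1,1),\quad b_2^X=(t_2,2),\quad b_3^X=(t_3,0),$$ $$b_1^Y=(1,s_1),\quad b_2^Y=(3,s_2),\quad b_3^Y=(-1,s_3),$$ $$c_1=(t_1,0),\quad c_2=(t_2,1),\quad c_3=(t_3,2).$$ Assume that there exist sets $S^X,S^Y\subseteq\mathbb{Z}_m^\ast$ such that: - $(X_1)$ $k+1\notin S^X$ and $-t_1\notin S^X$; - $(X_2)$ $1-t_1\in S^X$ and $-2-t_1\in S^X$; - $(X_3)$ $\vec{C}\big(m;\mathbb{Z}_m^\ast\setminus(S^X\cup\{k+1,-t_1\})\big)$ admits a directed $m$-cycle decomposition; - $(X_4)$ $\vec{C}(m;S^X)-\{b_1^X,b_2^X,b_3^X\}+\{c_1,c_2,c_3\}$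 admits a directed $m$-cycle decomposition; - $(Y_1)$ $k+1\notin S^Y$; - $(Y_2)$ $s_1-1\in S^Y$ and $s_1+5\in S^Y$; - $(Y_3)$ $\vec{C}\big(m;\mathbb{Z}_m^\ast\setminus(S^Y\cup\{k+1\})\big)$ admits a directed $m$-cycle decomposition; - $(Y_4)$ $\vec{C}(m;S^Y)-\{b_1^Y,b_2^Y,b_3^Y\}$ admits a decomposition into directed $m$-cycles and three pairwise vertex-disjoint directed paths: an $(s_1,-1)$-path of length $\frac{2m}{3}-1$, an $(s_2,3)$-path of some length $q\in\{1,\ldots,\frac{m}{3}-3\}$, and an $(s_3,1)$-path of length $\frac{m}{3}-2-q$. Then $K_{2m}^\ast$ admits a resolvable directed $m$-cycle decomposition. -/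

import Mathlib

namespace DirectedCycles

variable {V : Type*}

/-- The complete symmetric digraph on the vertex set `V`: an arc `(u, v)` for every ordered pair
of distinct vertices, and no loops. -/
def completeSymmetric (V : Type*) : Digraph V where
  Adj u v := u ≠ v

/-- The digraph `D - A`, obtained from `D` by deleting all arcs in `A`. -/
def deleteArcs (D : Digraph V) (A : Set (V × V)) : Digraph V where
  Adj u v := D.Adj u v ∧ (u, v) ∉ A

/-- The digraph `D + A`, obtained from `D` by adding all arcs in `A`. -/
def addArcs (D : Digraph V) (A : Set (V × V)) : Digraph V where
  Adj u v := D.Adj u v ∨ (u, v) ∈ A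

/-- The directed circulant of order `m` with connection set `S`: its vertex set is `ZMod m` and
its arcs are the pairs `(i, i + d)` with `d ∈ S`. -/
def circulant (m : ℕ) (S : Set (ZMod m)) : Digraph (ZMod m) where
  Adj i j := ∃ d ∈ S, j = i + d

/-- A digraph whose vertices are taken from `V` (not necessarily all of `V`), given by its vertex
set and its arc set. -/
@[ext]
structure Subdigraph (V : Type*) where
  verts : Set V
  arcs : Set (V × V)
  arcs_subset : arcs ⊆ verts ×ˢ verts

/-- `H` is a directed cycle of length `m`: its vertices are `m ≥ 2` distinct vertices
`c 0, c 1, …, c (m - 1)`, and its arcs are the pairs `(c i, c (i + 1))`, indices modulo `m`. -/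
def IsDirectedCycle (m : ℕ) (H : Subdigraph V) : Prop :=
  2 ≤ m ∧ ∃ c : ZMod m → V, Function.Injective c ∧
    H.verts = Set.range c ∧ H.arcs = Set.range fun i => (c i, c (i + 1))

/-- `H` is a directed `(u, v)`-path of length `n`: its vertices are `n + 1` distinct vertices
`p 0 = u, p 1, …, p n = v`, and its arcs are the `n` pairs `(p i, p (i + 1))`. -/
def IsDirectedPath (u v : V) (n : ℕ) (H : Subdigraph V) : Prop :=
  ∃ p : Fin (n + 1) → V, Function.Injective p ∧ p 0 = u ∧ p (Fin.last n) = v ∧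
    H.verts = Set.range p ∧ H.arcs = Set.range fun i : Fin n => (p i.castSucc, p i.succ)

/-- `𝓓` is a decomposition of `D`: a collection of subdigraphs of `D` whose arc sets partition
the arc set of `D`. -/
def IsDecomposition (D : Digraph V) (𝓓 : Set (Subdigraph V)) : Prop :=
  (∀ H ∈ 𝓓, H.arcs.Nonempty ∧ ∀ a ∈ H.arcs, D.Adj a.1 a.2) ∧
    ∀ u v : V, D.Adj u v → ∃! H, H ∈ 𝓓 ∧ (u, v) ∈ H.arcs

/-- `𝓓` is a decomposition of `D` into directed cycles of length `m`. -/
def IsCycleDecomposition (m : ℕ) (D : Digraph V) (𝓓 : Set (Subdigraph V)) : Prop :=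
  IsDecomposition D 𝓓 ∧ ∀ H ∈ 𝓓, IsDirectedCycle m H

/-- `D` admits a decomposition into directed cycles of length `m`. -/
def HasCycleDecomposition (m : ℕ) (D : Digraph V) : Prop :=
  ∃ 𝓓 : Set (Subdigraph V), IsCycleDecomposition m D 𝓓

/-- `R` is a resolution class (on the vertex set `V`): the vertex sets of the members of `R`
partition `V`. -/
def IsResolutionClass (R : Set (Subdigraph V)) : Prop :=
  (∀ H ∈ R, H.verts.Nonempty) ∧ ∀ v : V, ∃! H, H ∈ R ∧ v ∈ H.verts

/-- A collection `𝓓` is resolvable if it can be partitioned into resolution classes. -/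
def IsResolvable (𝓓 : Set (Subdigraph V)) : Prop :=
  ∃ 𝓡 : Set (Set (Subdigraph V)),
    (∀ R ∈ 𝓡, R.Nonempty ∧ R ⊆ 𝓓 ∧ IsResolutionClass R) ∧
      ∀ H ∈ 𝓓, ∃! R, R ∈ 𝓡 ∧ H ∈ R

/-- `D` admits a resolvable decomposition into directed cycles of length `m`. -/
def HasResolvableCycleDecomposition (m : ℕ) (D : Digraph V) : Prop :=
  ∃ 𝓓 : Set (Subdigraph V), IsCycleDecomposition m D 𝓓 ∧ IsResolvable 𝓓

/-- The table of values of the parameter `s₁`, by the residue of `k` modulo 4.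
All divisions are exact. -/
def tableS (k : ℕ) : ℕ :=
  if k % 4 = 0 then k / 2
  else if k % 4 = 1 then (3 * k + 1) / 2
  else if k % 4 = 2 then k / 2
  else (3 * k + 1) / 2

/-- The table of values of the parameter `t₁`, by the residue of `k` modulo 4.
All divisions are exact. -/
def tableT (k : ℕ) : ℕ :=
  if k % 4 = 0 then 3 * k / 4
  else if k % 4 = 1 then (k - 1) / 4
  else if k % 4 = 2 then (7 * k + 2) / 4
  else (5 * k + 1) / 4

end DirectedCycles

/-! Take two copies x, y of Z_m as vertices and let h = k + 1, the inverse of 2; every row of the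
tables then says s₁ = -h² = -1/4 and t₁ = -3h³ = -3/8. The aim is 2m - 1 factors, each consisting of
two m-cycles. It suffices that they cover all arcs: at each vertex u, the 2m - 1 factors must supply
2m - 1 distinct successors, so no arc can occur twice.

There are m zigzag factors, one per r in Z_m. They use all pure arcs of difference h and all mixed
arcs except x_i → y_{2i+h} and y_{2i-1} → x_i. Index x_p by p and y_{2p-h²} by p; both leftover
families then advance the index by 3h³ = -t₁, a step of order M = m/3. So they run along three
helices, the cosets of 3Z_m represented by 0, 1, 2.

Cut each helix where it returns to its representative. Inside the cut, the leftover mixed arcs form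
alternating paths, which the arcs b^X and b^Y join into one m-cycle on each end side
(`hasTwoCycleFactor_mixedArc`). The six mixed arcs across the cut join the pure x-paths of
difference -t₁ to the three y-paths of (Y₄) (`hasTwoCycleFactor_linkArc`); the pure x-arcs of
difference -t₁ across the cut are the c_i.

What remains on each side is decomposed into Hamiltonian cycles by the hypotheses. There are at most
m - 3 on each side (`exists_hamiltonian_family`), and pairing an x-cycle with a y-cycle gives the
last m - 3 factors. -/

namespace DirectedCycles

/-! ### Covering implies decomposition, by counting -/

/-- A family of `2m - 1` pairs of cyclic sequences of length `m`, each pair enumerating all `2m`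
vertices, that covers all arcs of the complete symmetric digraph is a resolvable decomposition. -/
theorem hasResolvableCycleDecomposition_of_covering {V ι : Type*} [Fintype V] [Fintype ι]
    {m : ℕ} (hm : 2 ≤ m) (hV : Fintype.card V = 2 * m) (hι : Fintype.card ι = 2 * m - 1)
    (c : ι → Bool × ZMod m → V) (hc : ∀ f, Function.Surjective (c f))
    (hcov : ∀ u v, u ≠ v → ∃ f b n, c f (b, n) = u ∧ c f (b, n + 1) = v) :
    HasResolvableCycleDecomposition m (completeSymmetric V) := by
  classical
  have : NeZero m := ⟨by omega⟩
  have : Fact (1 < m) := ⟨by omega⟩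
  have hbij : ∀ f, Function.Bijective (c f) := fun f =>
    (Fintype.bijective_iff_surjective_and_card _).2 ⟨hc f, by simp [ZMod.card, hV]⟩
  have hinj : ∀ f, Function.Injective (c f) := fun f => (hbij f).1
  have hinjb : ∀ f b, Function.Injective fun n => c f (b, n) := fun f b x y hxy => by
    simpa using hinj f hxy
  have hne : ∀ f b n, c f (b, n) ≠ c f (b, n + 1) := fun f b n h => by
    simpa using hinjb f b h
  let H : ι × Bool → Subdigraph V := fun p =>
    { verts := Set.range fun n => c p.1 (p.2, n)
      arcs := Set.range fun n => (c p.1 (p.2, n), c p.1 (p.2, n + 1))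
      arcs_subset := by
        rintro _ ⟨n, rfl⟩
        exact ⟨⟨n, rfl⟩, ⟨n + 1, rfl⟩⟩ }
  have huniq : ∀ p q u v, (u, v) ∈ (H p).arcs → (u, v) ∈ (H q).arcs → p = q := by
    rintro ⟨f, b⟩ ⟨f', b'⟩ u v ⟨n, hn⟩ ⟨n', hn'⟩
    simp only [Prod.mk.injEq] at hn hn'
    let e : ∀ f, Bool × ZMod m ≃ V := fun f => Equiv.ofBijective _ (hbij f)
    -- The successor of the fixed vertex u, as a function of the factor: a surjection between two
    -- sets of size 2m - 1, hence injective.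
    let nx : ι → {w // w ≠ u} := fun f =>
      ⟨c f (((e f).symm u).1, ((e f).symm u).2 + 1), fun h => by
        have h1 := hne f ((e f).symm u).1 ((e f).symm u).2
        rw [h] at h1
        exact h1 ((e f).apply_symm_apply u)⟩
    have hnx : ∀ f b n, c f (b, n) = u → (nx f : V) = c f (b, n + 1) := by
      intro f b n h
      have h1 : (e f).symm u = (b, n) := by rw [Equiv.symm_apply_eq]; exact h.symm
      simp [nx, h1]
    have hs : Function.Surjective nx := by
      rintro ⟨w, hw⟩
      obtain ⟨f, b, n, h1, h2⟩ := hcov u w (Ne.symm hw)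
      exact ⟨f, Subtype.ext ((hnx f b n h1).trans h2)⟩
    have hb : Function.Bijective nx :=
      (Fintype.bijective_iff_surjective_and_card _).2 ⟨hs, by
        rw [hι, Fintype.card_subtype_compl, hV]; simp⟩
    have hff : f = f' := by
      apply hb.1
      apply Subtype.ext
      rw [hnx f b n hn.1, hnx f' b' n' hn'.1, hn.2, hn'.2]
    subst hff
    have := hinj f (hn.1.trans hn'.1.symm)
    simp only [Prod.mk.injEq] at this
    rw [this.1]
  have harc : ∀ p, (H p).arcs.Nonempty := fun p => ⟨_, ⟨0, rfl⟩⟩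
  have hHinj : Function.Injective H := by
    intro p q hpq
    obtain ⟨⟨u, v⟩, h⟩ := harc p
    exact huniq p q u v h (hpq ▸ h)
  refine ⟨Set.range H, ⟨⟨?_, ?_⟩, ?_⟩, ?_⟩
  · rintro _ ⟨p, rfl⟩
    refine ⟨harc p, ?_⟩
    rintro _ ⟨n, rfl⟩
    exact hne p.1 p.2 n
  · intro u v huv
    obtain ⟨f, b, n, h1, h2⟩ := hcov u v huv
    have hmem : (u, v) ∈ (H (f, b)).arcs := ⟨n, by simp [h1, h2]⟩
    refine ⟨H (f, b), ⟨⟨_, rfl⟩, hmem⟩, ?_⟩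
    rintro _ ⟨⟨q, rfl⟩, hq⟩
    rw [huniq q (f, b) u v hq hmem]
  · rintro _ ⟨p, rfl⟩
    exact ⟨hm, fun n => c p.1 (p.2, n), hinjb _ _, rfl, rfl⟩
  · refine ⟨Set.range fun f => {H (f, false), H (f, true)}, ?_, ?_⟩
    · rintro _ ⟨f, rfl⟩
      refine ⟨⟨_, Or.inl rfl⟩, ?_, ?_, ?_⟩
      · rintro _ (rfl | rfl) <;> exact ⟨_, rfl⟩
      · rintro _ (rfl | rfl) <;> exact ⟨_, ⟨0, rfl⟩⟩
      · intro v
        obtain ⟨⟨b, n⟩, hbn⟩ := hc f v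
        have hR : ∀ b, H (f, b) ∈ ({H (f, false), H (f, true)} : Set (Subdigraph V)) := by
          rintro (_ | _) <;> simp
        refine ⟨H (f, b), ⟨hR b, ⟨n, hbn⟩⟩, ?_⟩
        have key : ∀ b', v ∈ (H (f, b')).verts → H (f, b') = H (f, b) := by
          rintro b' ⟨n', hn'⟩
          have := hinj f (hn'.trans hbn.symm)
          simp only [Prod.mk.injEq] at this
          rw [this.1]
        rintro _ ⟨rfl | rfl, hv⟩
        · exact key _ hv
        · exact key _ hv
    · rintro _ ⟨⟨f, b⟩, rfl⟩
      refine ⟨{H (f, false), H (f, true)}, ⟨⟨f, rfl⟩, by cases b <;> simp⟩, ?_⟩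
      rintro _ ⟨⟨f', rfl⟩, h⟩
      have : f = f' := by
        rcases h with h | h
        · exact congrArg Prod.fst (hHinj h)
        · exact congrArg Prod.fst (hHinj h)
      rw [this]

/-! ### Factors as pairs of cyclic lists -/

/-- `v` follows `u` in the list `l`, read cyclically. -/
def Follows {V : Type*} (l : List V) (u v : V) : Prop := [u, v] <:+: l ++ l.take 1

/-- There are two cyclic lists of length `m` that together contain all elements of `V`, such that
`v` follows `u` in one of them whenever `A u v`. -/
def HasTwoCycleFactor {V : Type*} (m : ℕ) (A : V → V → Prop) : Prop :=
  ∃ l₁ l₂ : List V, l₁.length = m ∧ l₂.length = m ∧ (∀ v, v ∈ l₁ ∨ v ∈ l₂) ∧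
    ∀ u v, A u v → Follows l₁ u v ∨ Follows l₂ u v

theorem Follows.exists_getElem {V : Type*} {m : ℕ} [NeZero m] {l : List V} (hl : l.length = m)
    {u v : V} (h : Follows l u v) :
    ∃ n : ZMod m, l[n.val]'(by rw [hl]; exact n.val_lt) = u ∧
      l[(n + 1).val]'(by rw [hl]; exact (n + 1).val_lt) = v := by
  have hm : 0 < m := Nat.pos_of_neZero m
  obtain ⟨s, t, hst⟩ := h
  have hlen := congrArg List.length hst
  have ht : (l.take 1).length = 1 := by rw [List.length_take]; omega
  simp only [List.length_append, List.length_cons, List.length_nil, ht, hl] at hlen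
  have h1 : (l ++ l.take 1)[s.length]? = some u := by rw [← hst]; simp
  have h2 : (l ++ l.take 1)[s.length + 1]? = some v := by rw [← hst]; simp
  rw [List.getElem?_append_left (by omega)] at h1
  have hval : ((s.length : ZMod m)).val = s.length := ZMod.val_cast_of_lt (by omega)
  refine ⟨(s.length : ZMod m), ?_, ?_⟩
  · simp only [hval]
    rw [List.getElem?_eq_getElem (by omega)] at h1
    exact Option.some.inj h1
  · by_cases hs : s.length + 1 < m
    · have hval' : ((s.length : ZMod m) + 1).val = s.length + 1 := by
        have := ZMod.val_cast_of_lt hs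
        push_cast at this
        exact this
      simp only [hval']
      rw [List.getElem?_append_left (by omega), List.getElem?_eq_getElem (by omega)] at h2
      exact Option.some.inj h2
    · have hs' : s.length + 1 = m := by omega
      have hval' : ((s.length : ZMod m) + 1).val = 0 := by
        have : ((s.length : ZMod m) + 1) = 0 := by
          rw [← Nat.cast_one, ← Nat.cast_add, hs', ZMod.natCast_self]
        rw [this, ZMod.val_zero]
      simp only [hval']
      rw [List.getElem?_append_right (by omega), hl, hs', Nat.sub_self,
        List.getElem?_take_of_lt (by omega), List.getElem?_eq_getElem (by omega)] at h2
      exact Option.some.inj h2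

theorem hasResolvableCycleDecomposition_of_hasTwoCycleFactor {V W ι : Type*} [Fintype W]
    [Fintype ι] (e : V ≃ W) {m : ℕ} (hm : 2 ≤ m) (hW : Fintype.card W = 2 * m)
    (hι : Fintype.card ι = 2 * m - 1) (A : ι → V → V → Prop)
    (hA : ∀ f, HasTwoCycleFactor m (A f)) (hcov : ∀ u v, u ≠ v → ∃ f, A f u v) :
    HasResolvableCycleDecomposition m (completeSymmetric W) := by
  have : NeZero m := ⟨by omega⟩
  choose l₁ l₂ h₁ h₂ hmem hfol using hA
  have hlt : ∀ f (n : ZMod m), n.val < (l₁ f).length := fun f n => by rw [h₁]; exact n.val_lt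
  have hlt' : ∀ f (n : ZMod m), n.val < (l₂ f).length := fun f n => by rw [h₂]; exact n.val_lt
  refine hasResolvableCycleDecomposition_of_covering hm hW hι
    (fun f p => e (if p.1 then (l₁ f)[p.2.val]'(hlt f _) else (l₂ f)[p.2.val]'(hlt' f _))) ?_ ?_
  · intro f w
    rcases hmem f (e.symm w) with h | h
    · obtain ⟨n, hn, hw⟩ := List.getElem_of_mem h
      refine ⟨(true, (n : ZMod m)), ?_⟩
      have : ((n : ZMod m)).val = n := ZMod.val_cast_of_lt (by rw [← h₁ f]; exact hn)
      simp [this, hw]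
    · obtain ⟨n, hn, hw⟩ := List.getElem_of_mem h
      refine ⟨(false, (n : ZMod m)), ?_⟩
      have : ((n : ZMod m)).val = n := ZMod.val_cast_of_lt (by rw [← h₂ f]; exact hn)
      simp [this, hw]
  · intro u v huv
    obtain ⟨f, hf⟩ := hcov (e.symm u) (e.symm v) (by simpa using huv)
    rcases hfol f _ _ hf with h | h
    · obtain ⟨n, hu, hv⟩ := h.exists_getElem (h₁ f)
      exact ⟨f, true, n, by simp [hu], by simp [hv]⟩
    · obtain ⟨n, hu, hv⟩ := h.exists_getElem (h₂ f)
      exact ⟨f, false, n, by simp [hu], by simp [hv]⟩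

/-! ### Consecutive entries in concatenated lists -/

section Lists

variable {V : Type*} {l l₁ l₂ : List V} {u v : V}

theorem infix_append_of_getLast?_head? (h₁ : l₁.getLast? = some u) (h₂ : l₂.head? = some v) :
    [u, v] <:+: l₁ ++ l₂ := by
  obtain ⟨s, rfl⟩ := List.getLast?_eq_some_iff.1 h₁
  obtain ⟨t, rfl⟩ := List.head?_eq_some_iff.1 h₂
  exact ⟨s, t, by simp⟩

theorem infix_append_left (h : [u, v] <:+: l₁) : [u, v] <:+: l₁ ++ l₂ :=
  h.trans (List.prefix_append _ _).isInfix

theorem infix_append_right (h : [u, v] <:+: l₂) : [u, v] <:+: l₁ ++ l₂ :=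
  h.trans (List.suffix_append _ _).isInfix

theorem Follows.of_infix (h : [u, v] <:+: l) : Follows l u v :=
  infix_append_left h

theorem Follows.of_getLast?_head? (h₁ : l.getLast? = some u) (h₂ : l.head? = some v) :
    Follows l u v := by
  refine infix_append_of_getLast?_head? h₁ ?_
  obtain ⟨t, rfl⟩ := List.head?_eq_some_iff.1 h₂
  simp

theorem infix_map_range (g : ℕ → V) {n m : ℕ} (h : n + 1 < m) :
    [g n, g (n + 1)] <:+: (List.range m).map g := by
  obtain ⟨k, rfl⟩ := Nat.exists_eq_add_of_le (show n + 2 ≤ m from h)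
  refine ⟨(List.range n).map g, (List.range k).map fun i => g (n + 2 + i), ?_⟩
  rw [List.range_add, List.range_succ, List.range_succ]
  simp [Function.comp_def]

theorem head?_map_range (g : ℕ → V) {m : ℕ} (hm : 0 < m) :
    ((List.range m).map g).head? = some (g 0) := by
  obtain ⟨k, rfl⟩ := Nat.exists_eq_succ_of_ne_zero hm.ne'
  rw [List.range_succ_eq_map]
  simp

theorem getLast?_map_range (g : ℕ → V) {m : ℕ} (hm : 0 < m) :
    ((List.range m).map g).getLast? = some (g (m - 1)) := by
  obtain ⟨k, rfl⟩ := Nat.exists_eq_succ_of_ne_zero hm.ne'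
  rw [Nat.succ_eq_add_one, List.range_succ]
  simp

theorem follows_map_range (g : ℕ → V) {n m : ℕ} (h : n + 1 < m) :
    Follows ((List.range m).map g) (g n) (g (n + 1)) :=
  .of_infix (infix_map_range g h)

theorem follows_map_range_last (g : ℕ → V) {m : ℕ} (hm : 0 < m) :
    Follows ((List.range m).map g) (g (m - 1)) (g 0) :=
  .of_getLast?_head? (getLast?_map_range g hm) (head?_map_range g hm)

theorem IsDirectedPath.exists_list {n : ℕ} {H : Subdigraph V} (hH : IsDirectedPath u v n H) :
    ∃ l : List V, l.length = n + 1 ∧ l.head? = some u ∧ l.getLast? = some v ∧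
      (∀ w ∈ H.verts, w ∈ l) ∧ ∀ a ∈ H.arcs, [a.1, a.2] <:+: l := by
  obtain ⟨p, -, rfl, rfl, hverts, harcs⟩ := hH
  let g : ℕ → V := fun i => p (Fin.ofNat (n + 1) i)
  have hg : ∀ i : Fin (n + 1), g i = p i := fun i => by simp [g]
  refine ⟨(List.range (n + 1)).map g, by simp, ?_, ?_, ?_, ?_⟩
  · rw [head?_map_range g n.succ_pos, ← hg 0]
    rfl
  · rw [getLast?_map_range g n.succ_pos, ← hg (Fin.last n)]
    rfl
  · rw [hverts]
    rintro _ ⟨i, rfl⟩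
    exact List.mem_map.2 ⟨i, List.mem_range.2 i.2, hg i⟩
  · rw [harcs]
    rintro _ ⟨i, rfl⟩
    have := infix_map_range g (Nat.succ_lt_succ i.2)
    have h1 : g i = p i.castSucc := hg i.castSucc
    have h2 : g (i + 1) = p i.succ := hg i.succ
    rwa [h1, h2] at this

theorem IsDirectedPath.ncard_verts {n : ℕ} {H : Subdigraph V} (hH : IsDirectedPath u v n H) :
    H.verts.ncard = n + 1 := by
  obtain ⟨p, hp, -, -, hverts, -⟩ := hH
  rw [hverts, ← Set.image_univ, Set.ncard_image_of_injective _ hp]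
  simp

end Lists

/-! ### Zigzag factors and pure factors -/

section Factors

variable {m : ℕ} [NeZero m]

theorem follows_map_range_natCast {V : Type*} (f : ZMod m → V) (n : ZMod m) :
    Follows ((List.range m).map fun i : ℕ => f (i : ZMod m)) (f n) (f (n + 1)) := by
  have hm : 0 < m := Nat.pos_of_neZero m
  have hn : ((n.val : ℕ) : ZMod m) = n := ZMod.natCast_zmod_val n
  by_cases h : n.val + 1 < m
  · have := follows_map_range (fun i : ℕ => f (i : ZMod m)) h
    simpa [hn] using this
  · have := follows_map_range_last (fun i : ℕ => f (i : ZMod m)) hm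
    have hv : n.val + 1 = m := by have := n.val_lt; omega
    have h0 : n + 1 = 0 := by
      rw [← hn, ← Nat.cast_one, ← Nat.cast_add, hv, ZMod.natCast_self]
    have hm1 : m - 1 = n.val := by omega
    simpa [hn, hm1, h0] using this

theorem mem_map_range_natCast {V : Type*} (f : ZMod m → V) (n : ZMod m) :
    f n ∈ (List.range m).map fun i : ℕ => f (i : ZMod m) :=
  List.mem_map.2 ⟨n.val, List.mem_range.2 n.val_lt, by simp⟩

/-- The arcs of a zigzag factor: both sides carry one pure arc of difference `h`, all other
arcs are mixed. -/
inductive ZigzagArc (h r : ZMod m) : ZMod m ⊕ ZMod m → ZMod m ⊕ ZMod m → Prop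
  | xx : ZigzagArc h r (.inl r) (.inl (h + r))
  | yy : ZigzagArc h r (.inr (2 * r)) (.inr (h + 2 * r))
  | xy (i : ZMod m) (hi : i ≠ 0) : ZigzagArc h r (.inl (i + r)) (.inr (i + h + 2 * r))
  | yx (j : ZMod m) (hj : j ≠ 0) : ZigzagArc h r (.inr (j + 2 * r)) (.inl (j + h + r))

/-- Walk with step h and change sides each time, once starting in x and once in y. As m is odd, such
a walk of m points ends on its starting side, so its closing arc is the only pure one. -/
theorem hasTwoCycleFactor_zigzagArc (hodd : Odd m) {h : ZMod m} (hh : 2 * h = 1) (r : ZMod m) :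
    HasTwoCycleFactor m (ZigzagArc h r) := by
  have hm : 0 < m := Nat.pos_of_neZero m
  let x : ℕ → ZMod m ⊕ ZMod m := fun n => .inl (h * (n + 1) + r)
  let y : ℕ → ZMod m ⊕ ZMod m := fun n => .inr (h * (n + 1) + 2 * r)
  let g₁ : ℕ → ZMod m ⊕ ZMod m := fun n => if Even n then x n else y n
  let g₂ : ℕ → ZMod m ⊕ ZMod m := fun n => if Even n then y n else x n
  -- Position p is reached at time n ≡ 2p - 1; this is the last time m - 1 exactly when p = 0, which
  -- is why index 0 is excluded from the mixed arcs.
  have hpos : ∀ p : ZMod m, ∃ n < m, h * (n + 1) = p ∧ (p ≠ 0 → n + 1 < m) := by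
    intro p
    have hv : (((2 * p - 1 : ZMod m).val : ℕ) : ZMod m) = 2 * p - 1 := ZMod.natCast_zmod_val _
    refine ⟨(2 * p - 1).val, ZMod.val_lt _, ?_, ?_⟩
    · rw [hv]
      linear_combination p * hh
    · intro hp
      by_contra hlt
      have h1 : (2 * p - 1).val + 1 = m := by
        have := (2 * p - 1).val_lt
        omega
      have h2 : (((2 * p - 1).val + 1 : ℕ) : ZMod m) = 0 := by rw [h1, ZMod.natCast_self]
      push_cast at h2
      rw [hv] at h2
      exact hp (by linear_combination h * h2 - p * hh)
  have hlast : ((m - 1 : ℕ) : ZMod m) + 1 = 0 := by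
    have : ((m - 1 + 1 : ℕ) : ZMod m) = 0 := by rw [Nat.sub_add_cancel hm, ZMod.natCast_self]
    exact_mod_cast this
  have heven : Even (m - 1) := Nat.Odd.sub_odd hodd odd_one
  refine ⟨(List.range m).map g₁, (List.range m).map g₂, by simp, by simp, ?_, ?_⟩
  · rintro (p | p)
    · obtain ⟨n, hn, hp, -⟩ := hpos (p - r)
      have hx : x n = .inl p := by simp [x, hp]
      by_cases he : Even n
      · exact .inl (List.mem_map.2 ⟨n, List.mem_range.2 hn, by simp [g₁, he, hx]⟩)
      · exact .inr (List.mem_map.2 ⟨n, List.mem_range.2 hn, by simp [g₂, he, hx]⟩)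
    · obtain ⟨n, hn, hp, -⟩ := hpos (p - 2 * r)
      have hx : y n = .inr p := by simp [y, hp]
      by_cases he : Even n
      · exact .inr (List.mem_map.2 ⟨n, List.mem_range.2 hn, by simp [g₂, he, hx]⟩)
      · exact .inl (List.mem_map.2 ⟨n, List.mem_range.2 hn, by simp [g₁, he, hx]⟩)
  · intro u v huv
    cases huv with
    | xx =>
      left
      have := follows_map_range_last g₁ hm
      simpa [g₁, x, heven, hlast] using this
    | yy =>
      right
      have := follows_map_range_last g₂ hm
      simpa [g₂, y, heven, hlast] using this
    | xy i hi =>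
      obtain ⟨n, -, hp, hlt⟩ := hpos i
      have h1 : x n = .inl (i + r) := by simp [x, hp]
      have h2 : y (n + 1) = .inr (i + h + 2 * r) := by
        simp only [y, ← hp]
        push_cast
        ring_nf
      rw [← h1, ← h2]
      by_cases he : Even n
      · left
        have := follows_map_range g₁ (hlt hi)
        simpa [g₁, he, Nat.even_add_one] using this
      · right
        have := follows_map_range g₂ (hlt hi)
        simpa [g₂, he, Nat.even_add_one] using this
    | yx j hj =>
      obtain ⟨n, -, hp, hlt⟩ := hpos j
      have h1 : y n = .inr (j + 2 * r) := by simp [y, hp]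
      have h2 : x (n + 1) = .inl (j + h + r) := by
        simp only [x, ← hp]
        push_cast
        ring_nf
      rw [← h1, ← h2]
      by_cases he : Even n
      · right
        have := follows_map_range g₂ (hlt hj)
        simpa [g₂, he, Nat.even_add_one] using this
      · left
        have := follows_map_range g₁ (hlt hj)
        simpa [g₁, he, Nat.even_add_one] using this

/-- The arcs of a Hamiltonian cycle on each of the two sides. -/
inductive PureArc (c d : ZMod m → ZMod m) : ZMod m ⊕ ZMod m → ZMod m ⊕ ZMod m → Prop
  | xx (n : ZMod m) : PureArc c d (.inl (c n)) (.inl (c (n + 1)))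
  | yy (n : ZMod m) : PureArc c d (.inr (d n)) (.inr (d (n + 1)))

theorem hasTwoCycleFactor_pureArc {c d : ZMod m → ZMod m} (hc : Function.Surjective c)
    (hd : Function.Surjective d) : HasTwoCycleFactor m (PureArc c d) := by
  refine ⟨(List.range m).map fun i : ℕ => .inl (c (i : ZMod m)),
    (List.range m).map fun i : ℕ => .inr (d (i : ZMod m)), by simp, by simp, ?_, ?_⟩
  · rintro (p | p)
    · obtain ⟨n, rfl⟩ := hc p
      exact .inl (mem_map_range_natCast (fun n => Sum.inl (c n)) n)
    · obtain ⟨n, rfl⟩ := hd p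
      exact .inr (mem_map_range_natCast (fun n => Sum.inr (d n)) n)
  · intro u v huv
    cases huv with
    | xx n => exact .inl (follows_map_range_natCast (fun n => Sum.inl (c n)) n)
    | yy n => exact .inr (follows_map_range_natCast (fun n => Sum.inr (d n)) n)

end Factors

/-! ### The two exceptional factors along the helices -/

section Helix

variable {m M : ℕ}

/-- The `n`-th point, starting from `a`, of a walk with steps `3 * h ^ 3`. -/
def helix (h : ZMod m) (a n : ℕ) : ZMod m := a + 3 * h ^ 3 * n

theorem helix_zero (h : ZMod m) (a : ℕ) : helix h a 0 = a := by simp [helix]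

theorem helix_succ (h : ZMod m) (a n : ℕ) : helix h a (n + 1) = helix h a n + 3 * h ^ 3 := by
  simp only [helix]
  push_cast
  ring

variable [NeZero m]

theorem helix_last (hM : m = 3 * M) (h : ZMod m) (a : ℕ) :
    helix h a (M - 1) = a - 3 * h ^ 3 := by
  have hM0 : 0 < M := by have := Nat.pos_of_neZero m; omega
  have h1 : helix h a M = a := by
    have : (3 * M : ZMod m) = 0 := by
      have := ZMod.natCast_self m
      rw [hM] at this ⊢
      exact_mod_cast this
    simp only [helix]
    linear_combination h ^ 3 * this
  have h2 := helix_succ h a (M - 1)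
  rw [Nat.sub_add_cancel hM0, h1] at h2
  linear_combination -h2

/-- Write p = a + 3b with a < 3. Since 8h³ = 1, the point is reached after 8b steps, and the number
of steps matters only modulo M because 3M = 0. -/
theorem exists_helix_eq (hM : m = 3 * M) {h : ZMod m} (hh : 2 * h = 1) (p : ZMod m) :
    ∃ a < 3, ∃ n < M, helix h a n = p := by
  have hM0 : 0 < M := by have := Nat.pos_of_neZero m; omega
  refine ⟨p.val % 3, Nat.mod_lt _ (by norm_num), 8 * (p.val / 3) % M, Nat.mod_lt _ hM0, ?_⟩
  have h1 : ((p.val % 3 + 3 * (p.val / 3) : ℕ) : ZMod m) = p := by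
    rw [Nat.mod_add_div]
    exact ZMod.natCast_zmod_val p
  have h2 : ((8 * (p.val / 3) % M + M * (8 * (p.val / 3) / M) : ℕ) : ZMod m) =
      (8 * (p.val / 3) : ℕ) := by rw [Nat.mod_add_div]
  have h3 : (3 * M : ZMod m) = 0 := by
    have := ZMod.natCast_self m
    rw [hM] at this ⊢
    exact_mod_cast this
  have h4 : 8 * h ^ 3 = 1 := by linear_combination (4 * h ^ 2 + 2 * h + 1) * hh
  simp only [helix]
  generalize 8 * (p.val / 3) % M = n at *
  generalize 8 * (p.val / 3) / M = n' at *
  generalize p.val % 3 = a at *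
  generalize p.val / 3 = b at *
  push_cast at h1 h2
  linear_combination h1 + 3 * h ^ 3 * h2 - h ^ 3 * n' * h3 + 3 * b * h4

/-- The mixed arcs along three helices, and the six pure arcs that link the two sides of these
helices to one cycle each. -/
inductive MixedArc (M : ℕ) (h : ZMod m) : ZMod m ⊕ ZMod m → ZMod m ⊕ ZMod m → Prop
  | xy (a n : ℕ) (ha : a < 3) (hn : n + 1 < M) :
      MixedArc M h (.inl (helix h a n)) (.inr (2 * helix h a (n + 1) - h ^ 2))
  | yx (a n : ℕ) (ha : a < 3) (hn : n + 1 < M) :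
      MixedArc M h (.inr (2 * helix h a n - h ^ 2)) (.inl (helix h a (n + 1)))
  | xx₀ : MixedArc M h (.inl (-3 * h ^ 3)) (.inl 1)
  | xx₁ : MixedArc M h (.inl (1 - 3 * h ^ 3)) (.inl 2)
  | xx₂ : MixedArc M h (.inl (2 - 3 * h ^ 3)) (.inl 0)
  | yy₀ : MixedArc M h (.inr (-1)) (.inr (4 - h ^ 2))
  | yy₁ : MixedArc M h (.inr 3) (.inr (2 - h ^ 2))
  | yy₂ : MixedArc M h (.inr 1) (.inr (-h ^ 2))

/-- As M is odd, an alternating path of M points starts and ends on the same side. Path a starting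
in x runs from x_a to x_{t₁+a}; the one starting in y runs from y_{s₁+2a} to y_{2a-1}. The linking
arcs b^X visit the helices in the order 0, 1, 2, while b^Y visit them in the order 0, 2, 1. -/
theorem hasTwoCycleFactor_mixedArc (hM : m = 3 * M) (hodd : Odd M) {h : ZMod m}
    (hh : 2 * h = 1) : HasTwoCycleFactor m (MixedArc M h) := by
  have hM0 : 0 < M := hodd.pos
  have heven : Even (M - 1) := Nat.Odd.sub_odd hodd odd_one
  let x : ℕ → ℕ → ZMod m ⊕ ZMod m := fun a n => .inl (helix h a n)
  let y : ℕ → ℕ → ZMod m ⊕ ZMod m := fun a n => .inr (2 * helix h a n - h ^ 2)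
  let s : ℕ → ℕ → ZMod m ⊕ ZMod m := fun a n => if Even n then x a n else y a n
  let t : ℕ → ℕ → ZMod m ⊕ ZMod m := fun a n => if Even n then y a n else x a n
  let S : ℕ → List (ZMod m ⊕ ZMod m) := fun a => (List.range M).map (s a)
  let T : ℕ → List (ZMod m ⊕ ZMod m) := fun a => (List.range M).map (t a)
  have hShead : ∀ a, (S a).head? = some (.inl a) := fun a => by
    simp only [S]
    rw [head?_map_range _ hM0]
    simp [s, x, helix_zero]
  have hSlast : ∀ a, (S a).getLast? = some (.inl (a - 3 * h ^ 3)) := fun a => by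
    simp only [S]
    rw [getLast?_map_range _ hM0]
    simp [s, x, helix_last hM, heven]
  have hThead : ∀ a, (T a).head? = some (.inr (2 * a - h ^ 2)) := fun a => by
    simp only [T]
    rw [head?_map_range _ hM0]
    simp [t, y, helix_zero]
  have hTlast : ∀ a, (T a).getLast? = some (.inr (2 * a - 1)) := fun a => by
    simp only [T]
    rw [getLast?_map_range _ hM0]
    simp only [t, y, helix_last hM, heven, if_true]
    congr 2
    linear_combination (-3 * h ^ 2 - 2 * h - 1) * hh
  have hlenS : ∀ a, (S a).length = M := fun a => by simp [S]
  have hlenT : ∀ a, (T a).length = M := fun a => by simp [T]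
  have hmemS : ∀ a < 3, ∀ v ∈ S a, v ∈ (S 0 ++ S 1) ++ S 2 := by
    intro a ha v hv
    interval_cases a <;> simp [hv]
  have hmemT : ∀ a < 3, ∀ v ∈ T a, v ∈ (T 0 ++ T 2) ++ T 1 := by
    intro a ha v hv
    interval_cases a <;> simp [hv]
  have hinS : ∀ a < 3, ∀ u v, [u, v] <:+: S a → Follows ((S 0 ++ S 1) ++ S 2) u v := by
    intro a ha u v huv
    apply Follows.of_infix
    interval_cases a
    · exact infix_append_left (infix_append_left huv)
    · exact infix_append_left (infix_append_right huv)
    · exact infix_append_right huv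
  have hinT : ∀ a < 3, ∀ u v, [u, v] <:+: T a → Follows ((T 0 ++ T 2) ++ T 1) u v := by
    intro a ha u v huv
    apply Follows.of_infix
    interval_cases a
    · exact infix_append_left (infix_append_left huv)
    · exact infix_append_right huv
    · exact infix_append_left (infix_append_right huv)
  refine ⟨(S 0 ++ S 1) ++ S 2, (T 0 ++ T 2) ++ T 1, ?_, ?_, ?_, ?_⟩
  · simp only [List.length_append, hlenS]
    omega
  · simp only [List.length_append, hlenT]
    omega
  · rintro (p | p)
    · obtain ⟨a, ha, n, hn, hp⟩ := exists_helix_eq hM hh p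
      by_cases he : Even n
      · exact .inl (hmemS a ha _ (List.mem_map.2 ⟨n, List.mem_range.2 hn, by simp [s, x, he, hp]⟩))
      · exact .inr (hmemT a ha _ (List.mem_map.2 ⟨n, List.mem_range.2 hn, by simp [t, x, he, hp]⟩))
    · obtain ⟨a, ha, n, hn, hp⟩ := exists_helix_eq hM hh (h * (p + h ^ 2))
      have hp' : 2 * helix h a n - h ^ 2 = p := by
        rw [hp]
        linear_combination (p + h ^ 2) * hh
      by_cases he : Even n
      · exact .inr (hmemT a ha _ (List.mem_map.2 ⟨n, List.mem_range.2 hn, by simp [t, y, he, hp']⟩))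
      · exact .inl (hmemS a ha _ (List.mem_map.2 ⟨n, List.mem_range.2 hn, by simp [s, y, he, hp']⟩))
  · intro u v huv
    cases huv with
    | xy a n ha hn =>
      by_cases he : Even n
      · refine .inl (hinS a ha _ _ ?_)
        have := infix_map_range (s a) hn
        simpa [s, x, y, he, Nat.even_add_one] using this
      · refine .inr (hinT a ha _ _ ?_)
        have := infix_map_range (t a) hn
        simpa [t, x, y, he, Nat.even_add_one] using this
    | yx a n ha hn =>
      by_cases he : Even n
      · refine .inr (hinT a ha _ _ ?_)
        have := infix_map_range (t a) hn
        simpa [t, x, y, he, Nat.even_add_one] using this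
      · refine .inl (hinS a ha _ _ ?_)
        have := infix_map_range (s a) hn
        simpa [s, x, y, he, Nat.even_add_one] using this
    | xx₀ =>
      refine .inl (.of_infix (infix_append_left (infix_append_of_getLast?_head? ?_ ?_)))
      · rw [hSlast]; simp
      · rw [hShead]; simp
    | xx₁ =>
      refine .inl (.of_infix (infix_append_of_getLast?_head? ?_ ?_))
      · rw [List.getLast?_append, hSlast]; simp
      · rw [hShead]; simp
    | xx₂ =>
      refine .inl (.of_getLast?_head? ?_ ?_)
      · rw [List.getLast?_append, hSlast]; simp
      · simp [hShead]
    | yy₀ =>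
      refine .inr (.of_infix (infix_append_left (infix_append_of_getLast?_head? ?_ ?_)))
      · rw [hTlast]; simp
      · rw [hThead]; norm_num
    | yy₁ =>
      refine .inr (.of_infix (infix_append_of_getLast?_head? ?_ ?_))
      · rw [List.getLast?_append, hTlast]; norm_num
      · rw [hThead]; simp
    | yy₂ =>
      refine .inr (.of_getLast?_head? ?_ ?_)
      · rw [List.getLast?_append, hTlast]; norm_num
      · simp [hThead]

/-- The arcs of three helices on the first side, the arcs of three paths on the second side, and
six mixed arcs that link these to two cycles. -/
inductive LinkArc (M : ℕ) (h : ZMod m) (Q₁ Q₂ Q₃ : Subdigraph (ZMod m)) :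
    ZMod m ⊕ ZMod m → ZMod m ⊕ ZMod m → Prop
  | xx (a n : ℕ) (ha : a < 3) (hn : n + 1 < M) :
      LinkArc M h Q₁ Q₂ Q₃ (.inl (helix h a n)) (.inl (helix h a (n + 1)))
  | yy₁ (i j : ZMod m) (hij : (i, j) ∈ Q₁.arcs) : LinkArc M h Q₁ Q₂ Q₃ (.inr i) (.inr j)
  | yy₂ (i j : ZMod m) (hij : (i, j) ∈ Q₂.arcs) : LinkArc M h Q₁ Q₂ Q₃ (.inr i) (.inr j)
  | yy₃ (i j : ZMod m) (hij : (i, j) ∈ Q₃.arcs) : LinkArc M h Q₁ Q₂ Q₃ (.inr i) (.inr j)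
  | xy (a : ℕ) (ha : a < 3) :
      LinkArc M h Q₁ Q₂ Q₃ (.inl (a - 3 * h ^ 3)) (.inr (-h ^ 2 + 2 * a))
  | yx (a : ℕ) (ha : a < 3) : LinkArc M h Q₁ Q₂ Q₃ (.inr (2 * a - 1)) (.inl a)

/-- With P_a the pure x-path on helix a, the two cycles are P₀ Q₁ and P₁ Q₂ P₂ Q₃, with M + 2M and
2M + M vertices. -/
theorem hasTwoCycleFactor_linkArc (hM : m = 3 * M) {h : ZMod m} (hh : 2 * h = 1)
    {Q₁ Q₂ Q₃ : Subdigraph (ZMod m)} {n₁ n₂ n₃ : ℕ} (hn₁ : n₁ + 1 = 2 * M)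
    (hn : n₂ + 1 + (n₃ + 1) = M) (hQ₁ : IsDirectedPath (-h ^ 2) (-1) n₁ Q₁)
    (hQ₂ : IsDirectedPath (-h ^ 2 + 2) 3 n₂ Q₂) (hQ₃ : IsDirectedPath (-h ^ 2 + 4) 1 n₃ Q₃)
    (h₁₂ : Disjoint Q₁.verts Q₂.verts) (h₁₃ : Disjoint Q₁.verts Q₃.verts)
    (h₂₃ : Disjoint Q₂.verts Q₃.verts) : HasTwoCycleFactor m (LinkArc M h Q₁ Q₂ Q₃) := by
  have hM0 : 0 < M := by omega
  -- The paths are disjoint and have 2M + M = m vertices in total, so they span the y-side.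
  have huniv : Q₁.verts ∪ (Q₂.verts ∪ Q₃.verts) = Set.univ := by
    apply Set.eq_of_subset_of_ncard_le (Set.subset_univ _)
    rw [Set.ncard_union_eq (Set.disjoint_union_right.2 ⟨h₁₂, h₁₃⟩), Set.ncard_union_eq h₂₃,
      hQ₁.ncard_verts, hQ₂.ncard_verts, hQ₃.ncard_verts, Set.ncard_univ, Nat.card_zmod]
    omega
  obtain ⟨l₁, hlen₁, hhead₁, hlast₁, hmem₁, harc₁⟩ := hQ₁.exists_list
  obtain ⟨l₂, hlen₂, hhead₂, hlast₂, hmem₂, harc₂⟩ := hQ₂.exists_list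
  obtain ⟨l₃, hlen₃, hhead₃, hlast₃, hmem₃, harc₃⟩ := hQ₃.exists_list
  let P : ℕ → List (ZMod m ⊕ ZMod m) := fun a =>
    (List.range M).map fun n => .inl (helix h a n)
  have hPhead : ∀ a, (P a).head? = some (.inl a) := fun a => by
    simp only [P]
    rw [head?_map_range _ hM0]
    simp [helix_zero]
  have hPlast : ∀ a, (P a).getLast? = some (.inl (a - 3 * h ^ 3)) := fun a => by
    simp only [P]
    rw [getLast?_map_range _ hM0, helix_last hM]
  have hlenP : ∀ a, (P a).length = M := fun a => by simp [P]
  have hinf : ∀ {l : List (ZMod m)} {i j}, [i, j] <:+: l →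
      [(.inr i : ZMod m ⊕ ZMod m), .inr j] <:+: l.map .inr := fun h => by
    simpa using h.map (Sum.inr : ZMod m → ZMod m ⊕ ZMod m)
  refine ⟨P 0 ++ l₁.map .inr, ((P 1 ++ l₂.map .inr) ++ P 2) ++ l₃.map .inr, ?_, ?_, ?_, ?_⟩
  · simp only [List.length_append, List.length_map, hlenP]
    omega
  · simp only [List.length_append, List.length_map, hlenP]
    omega
  · rintro (p | p)
    · obtain ⟨a, ha, n, hn, hp⟩ := exists_helix_eq hM hh p
      have : (.inl p : ZMod m ⊕ ZMod m) ∈ P a :=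
        List.mem_map.2 ⟨n, List.mem_range.2 hn, by rw [hp]⟩
      interval_cases a <;> simp [this]
    · have hp : p ∈ Q₁.verts ∪ (Q₂.verts ∪ Q₃.verts) := huniv ▸ Set.mem_univ p
      rcases hp with hp | hp | hp
      · simp [hmem₁ p hp]
      · simp [hmem₂ p hp]
      · simp [hmem₃ p hp]
  · intro u v huv
    cases huv with
    | xx a n ha hn =>
      have := infix_map_range (fun n => (.inl (helix h a n) : ZMod m ⊕ ZMod m)) hn
      interval_cases a
      · exact .inl (.of_infix (infix_append_left this))
      · exact .inr (.of_infix (infix_append_left (infix_append_left (infix_append_left this))))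
      · exact .inr (.of_infix (infix_append_left (infix_append_right this)))
    | yy₁ i j hij => exact .inl (.of_infix (infix_append_right (hinf (harc₁ _ hij))))
    | yy₂ i j hij =>
      exact .inr (.of_infix (infix_append_left (infix_append_left
        (infix_append_right (hinf (harc₂ _ hij))))))
    | yy₃ i j hij => exact .inr (.of_infix (infix_append_right (hinf (harc₃ _ hij))))
    | xy a ha =>
      interval_cases a
      · refine .inl (.of_infix (infix_append_of_getLast?_head? (hPlast 0) ?_))
        simp [hhead₁]
      · refine .inr (.of_infix (infix_append_left (infix_append_left
          (infix_append_of_getLast?_head? (hPlast 1) ?_))))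
        simp [hhead₂]
      · refine .inr (.of_infix (infix_append_of_getLast?_head? ?_ ?_))
        · rw [List.getLast?_append, hPlast]; simp
        · norm_num [hhead₃]
    | yx a ha =>
      interval_cases a
      · refine .inl (.of_getLast?_head? ?_ ?_)
        · simp [List.getLast?_append, hlast₁]
        · simp [hPhead]
      · refine .inr (.of_getLast?_head? ?_ ?_)
        · norm_num [List.getLast?_append, hlast₃]
        · simp [hPhead]
      · refine .inr (.of_infix (infix_append_left (infix_append_of_getLast?_head? ?_ ?_)))
        · norm_num [List.getLast?_append, hlast₂]
        · simp [hPhead]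

end Helix

/-! ### Counting Hamiltonian cycles at one vertex -/

section Decompositions

variable {V : Type*} {D D' : Digraph V} {𝓓 𝓓' : Set (Subdigraph V)} {u v : V}

theorem IsDecomposition.eq_of_mem_arcs (h : IsDecomposition D 𝓓) {H H' : Subdigraph V}
    (hH : H ∈ 𝓓) (hH' : H' ∈ 𝓓) {a : V × V} (ha : a ∈ H.arcs) (ha' : a ∈ H'.arcs) : H = H' :=
  (h.2 a.1 a.2 ((h.1 H hH).2 a ha)).unique ⟨hH, ha⟩ ⟨hH', ha'⟩

/-- Disjointness is required only for arcs out of the one vertex `u`, because a Hamiltonian cycle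
will be identified by its arc out of a fixed vertex. -/
theorem IsDecomposition.eq_of_mem_union (h : IsDecomposition D 𝓓) (h' : IsDecomposition D' 𝓓')
    (hD : ∀ v, D.Adj u v → ¬ D'.Adj u v) {H H' : Subdigraph V} (hH : H ∈ 𝓓 ∪ 𝓓')
    (hH' : H' ∈ 𝓓 ∪ 𝓓') (ha : (u, v) ∈ H.arcs) (ha' : (u, v) ∈ H'.arcs) : H = H' := by
  rcases hH with hH | hH <;> rcases hH' with hH' | hH'
  · exact h.eq_of_mem_arcs hH hH' ha ha'
  · exact absurd ((h'.1 _ hH').2 _ ha') (hD v ((h.1 _ hH).2 _ ha))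
  · exact absurd ((h'.1 _ hH).2 _ ha) (hD v ((h.1 _ hH').2 _ ha'))
  · exact h'.eq_of_mem_arcs hH hH' ha ha'

/-- Hamiltonian cycles whose arcs out of `v` are distinct and avoid a set `T` can be indexed by
`m - |T|` indices. -/
theorem exists_hamiltonian_family {m : ℕ} [NeZero m] {𝓓 : Set (Subdigraph (ZMod m))}
    (hcyc : ∀ H ∈ 𝓓, IsDirectedCycle m H) (v : ZMod m) (T : Finset (ZMod m))
    (hT : ∀ H ∈ 𝓓, ∀ w, (v, w) ∈ H.arcs → w ∉ T)
    (huniq : ∀ H ∈ 𝓓, ∀ H' ∈ 𝓓, ∀ w, (v, w) ∈ H.arcs → (v, w) ∈ H'.arcs → H = H') :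
    ∃ c : Fin (m - T.card) → ZMod m → ZMod m, (∀ f, Function.Surjective (c f)) ∧
      ∀ H ∈ 𝓓, ∀ i j, (i, j) ∈ H.arcs → ∃ f n, c f n = i ∧ c f (n + 1) = j := by
  classical
  have key : ∀ w : {w // w ∉ T}, ∃ c : ZMod m → ZMod m, Function.Surjective c ∧
      ∀ H ∈ 𝓓, (v, w.1) ∈ H.arcs → ∀ i j, (i, j) ∈ H.arcs → ∃ n, c n = i ∧ c (n + 1) = j := by
    intro w
    by_cases hw : ∃ H ∈ 𝓓, (v, w.1) ∈ H.arcs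
    · obtain ⟨H, hH, hvw⟩ := hw
      obtain ⟨-, c, hinj, -, harcs⟩ := hcyc H hH
      refine ⟨c, Finite.surjective_of_injective hinj, ?_⟩
      intro H' hH' hvw' i j hij
      rw [← huniq H hH H' hH' w hvw hvw', harcs] at hij
      obtain ⟨n, hn⟩ := hij
      exact ⟨n, congrArg Prod.fst hn, congrArg Prod.snd hn⟩
    · exact ⟨id, Function.surjective_id, fun H hH hvw => absurd ⟨H, hH, hvw⟩ hw⟩
  choose c hsurj hc using key
  have hcard : Fintype.card {w // w ∉ T} = m - T.card := by
    rw [Fintype.card_subtype_compl, ZMod.card, Fintype.card_coe]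
  let e := (Fintype.equivFinOfCardEq hcard).symm
  refine ⟨fun f => c (e f), fun f => hsurj _, ?_⟩
  intro H hH i j hij
  obtain ⟨-, d, hinj, -, harcs⟩ := hcyc H hH
  obtain ⟨n, hn⟩ := Finite.surjective_of_injective hinj v
  have hvw : (v, d (n + 1)) ∈ H.arcs := by
    rw [harcs]
    exact ⟨n, by simp [hn]⟩
  obtain ⟨n', h₁, h₂⟩ := hc ⟨d (n + 1), hT H hH _ hvw⟩ H hH hvw i j hij
  exact ⟨e.symm ⟨d (n + 1), hT H hH _ hvw⟩, n', by simpa using h₁, by simpa using h₂⟩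

end Decompositions

/-! ### The tabulated residues are -1/4 and -3/8 -/

theorem four_mul_tableS_add_one {m k : ℕ} (hm : m = 2 * k + 1) : m ∣ 4 * tableS k + 1 := by
  unfold tableS
  split_ifs
  · exact ⟨1, by omega⟩
  · exact ⟨3, by omega⟩
  · exact ⟨1, by omega⟩
  · exact ⟨3, by omega⟩

theorem eight_mul_tableT_add_three {m k : ℕ} (hm : m = 2 * k + 1) : m ∣ 8 * tableT k + 3 := by
  unfold tableT
  split_ifs
  · exact ⟨3, by omega⟩
  · exact ⟨1, by omega⟩
  · exact ⟨7, by omega⟩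
  · exact ⟨5, by omega⟩

theorem tableS_cast {m k : ℕ} (hm : m = 2 * k + 1) {h : ZMod m} (hh : 2 * h = 1) :
    (tableS k : ZMod m) = -h ^ 2 := by
  have := (ZMod.natCast_eq_zero_iff _ _).2 (four_mul_tableS_add_one hm)
  push_cast at this
  linear_combination h ^ 2 * this - (2 * h + 1) * (tableS k : ZMod m) * hh

theorem tableT_cast {m k : ℕ} (hm : m = 2 * k + 1) {h : ZMod m} (hh : 2 * h = 1) :
    (tableT k : ZMod m) = -3 * h ^ 3 := by
  have := (ZMod.natCast_eq_zero_iff _ _).2 (eight_mul_tableT_add_three hm)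
  push_cast at this
  linear_combination h ^ 3 * this - (4 * h ^ 2 + 2 * h + 1) * (tableT k : ZMod m) * hh

/-! ### Covering the mixed arcs -/

section Coverage

variable {m M : ℕ} [NeZero m] {h : ZMod m}

/-- The successors along a helix: either the helix goes on, or it ends in one of three points. -/
theorem helix_cases (hM : m = 3 * M) (hh : 2 * h = 1) (p : ZMod m) :
    (∃ a < 3, ∃ n, n + 1 < M ∧ p = helix h a n) ∨ ∃ a : ℕ, a < 3 ∧ p = a - 3 * h ^ 3 := by
  obtain ⟨a, ha, n, hn, rfl⟩ := exists_helix_eq hM hh p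
  by_cases h1 : n + 1 < M
  · exact .inl ⟨a, ha, n, h1, rfl⟩
  · refine .inr ⟨a, ha, ?_⟩
    rw [← helix_last hM, show n = M - 1 by omega]

/-- The only candidate zigzag is r = j - i - h, and it fails exactly on its omitted arc, i = r. The
exceptional arcs advance the helix, inside the cut for `MixedArc` and across it for `LinkArc`. -/
theorem arc_cover_xy (hM : m = 3 * M) (hh : 2 * h = 1) (Q₁ Q₂ Q₃ : Subdigraph (ZMod m))
    (i j : ZMod m) : (∃ r, ZigzagArc h r (.inl i) (.inr j)) ∨
      LinkArc M h Q₁ Q₂ Q₃ (.inl i) (.inr j) ∨ MixedArc M h (.inl i) (.inr j) := by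
  by_cases hij : j = 2 * i + h
  · right
    subst hij
    rcases helix_cases hM hh i with ⟨a, ha, n, hn, rfl⟩ | ⟨a, ha, rfl⟩
    · right
      convert MixedArc.xy (h := h) a n ha hn using 2
      rw [helix_succ]
      linear_combination (-3 * h ^ 2 - h) * hh
    · left
      convert LinkArc.xy (h := h) (Q₁ := Q₁) (Q₂ := Q₂) (Q₃ := Q₃) (M := M) a ha using 2
      linear_combination (-3 * h ^ 2 - h) * hh
  · left
    refine ⟨j - i - h, ?_⟩
    convert ZigzagArc.xy (h := h) (r := j - i - h) (2 * i + h - j) ?_ using 2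
    · ring
    · ring
    · exact fun h0 => hij (by linear_combination -h0)

theorem arc_cover_yx (hM : m = 3 * M) (hh : 2 * h = 1) (Q₁ Q₂ Q₃ : Subdigraph (ZMod m))
    (i j : ZMod m) : (∃ r, ZigzagArc h r (.inr j) (.inl i)) ∨
      LinkArc M h Q₁ Q₂ Q₃ (.inr j) (.inl i) ∨ MixedArc M h (.inr j) (.inl i) := by
  by_cases hij : j = 2 * i - 1
  · right
    subst hij
    -- The index of y_{2i-1} is one helix step before i.
    rcases helix_cases hM hh (i - 3 * h ^ 3) with ⟨a, ha, n, hn, hp⟩ | ⟨a, ha, hp⟩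
    · right
      convert MixedArc.yx (h := h) a n ha hn using 2
      · linear_combination 2 * hp + (3 * h ^ 2 + 2 * h + 1) * hh
      · rw [helix_succ]
        linear_combination hp
    · left
      have hi : i = a := by linear_combination hp
      rw [hi]
      exact LinkArc.yx a ha
  · left
    refine ⟨j - i + h, ?_⟩
    convert ZigzagArc.yx (h := h) (r := j - i + h) (2 * i - j - 1) ?_ using 2
    · linear_combination -hh
    · linear_combination -hh
    · exact fun h0 => hij (by linear_combination -h0)

end Coverage

end DirectedCycles

/-! ### Assembling the factors -/

open DirectedCycles in
theorem mainTheorem4 (m k : ℕ) (hm_odd : Odd m) (hm3 : 3 ∣ m) (hm15 : 15 ≤ m)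
    (hk : k = (m - 1) / 2)
    (s₁ s₂ s₃ t₁ t₂ t₃ : ZMod m)
    (hs₁ : s₁ = (DirectedCycles.tableS k : ZMod m)) (hs₂ : s₂ = s₁ + 2) (hs₃ : s₃ = s₁ + 4)
    (ht₁ : t₁ = (DirectedCycles.tableT k : ZMod m)) (ht₂ : t₂ = t₁ + 1) (ht₃ : t₃ = t₁ + 2)
    (SX SY : Set (ZMod m)) (hSX : SX ⊆ {0}ᶜ) (hSY : SY ⊆ {0}ᶜ)
    (hX1 : (k : ZMod m) + 1 ∉ SX ∧ -t₁ ∉ SX)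
    (hX2 : 1 - t₁ ∈ SX ∧ -2 - t₁ ∈ SX)
    (hX3 : DirectedCycles.HasCycleDecomposition m
      (DirectedCycles.circulant m ({0}ᶜ \ (SX ∪ {(k : ZMod m) + 1, -t₁}))))
    (hX4 : DirectedCycles.HasCycleDecomposition m
      (DirectedCycles.addArcs
        (DirectedCycles.deleteArcs (DirectedCycles.circulant m SX)
          {(t₁, 1), (t₂, 2), (t₃, 0)})
        {(t₁, 0), (t₂, 1), (t₃, 2)}))
    (hY1 : (k : ZMod m) + 1 ∉ SY)
    (hY2 : s₁ - 1 ∈ SY ∧ s₁ + 5 ∈ SY)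
    (hY3 : DirectedCycles.HasCycleDecomposition m
      (DirectedCycles.circulant m ({0}ᶜ \ (SY ∪ {(k : ZMod m) + 1}))))
    (hY4 : ∃ q : ℕ, 1 ≤ q ∧ q ≤ m / 3 - 3 ∧
      ∃ (Q₁ Q₂ Q₃ : DirectedCycles.Subdigraph (ZMod m))
        (𝓒 : Set (DirectedCycles.Subdigraph (ZMod m))),
        DirectedCycles.IsDirectedPath s₁ (-1) (2 * m / 3 - 1) Q₁ ∧
        DirectedCycles.IsDirectedPath s₂ 3 q Q₂ ∧
        DirectedCycles.IsDirectedPath s₃ 1 (m / 3 - 2 - q) Q₃ ∧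
        Disjoint Q₁.verts Q₂.verts ∧ Disjoint Q₁.verts Q₃.verts ∧ Disjoint Q₂.verts Q₃.verts ∧
        (∀ H ∈ 𝓒, DirectedCycles.IsDirectedCycle m H) ∧
        DirectedCycles.IsDecomposition
          (DirectedCycles.deleteArcs (DirectedCycles.circulant m SY)
            {(1, s₁), (3, s₂), (-1, s₃)})
          ({Q₁, Q₂, Q₃} ∪ 𝓒)) :
    DirectedCycles.HasResolvableCycleDecomposition m
      (DirectedCycles.completeSymmetric (Fin (2 * m))) := by
  have : NeZero m := ⟨by omega⟩
  obtain ⟨M, hM⟩ := hm3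
  have hMo : Odd M := by
    rw [hM, Nat.odd_mul] at hm_odd
    exact hm_odd.2
  have hmk : m = 2 * k + 1 := by obtain ⟨l, hl⟩ := hm_odd; omega
  set h : ZMod m := (k : ZMod m) + 1 with hhdef
  have hh : 2 * h = 1 := by
    have := ZMod.natCast_self m
    rw [congrArg (Nat.cast : ℕ → ZMod m) hmk] at this
    push_cast at this
    linear_combination this
  clear_value h
  have hs : s₁ = -h ^ 2 := hs₁.trans (DirectedCycles.tableS_cast hmk hh)
  have ht : t₁ = -3 * h ^ 3 := ht₁.trans (DirectedCycles.tableT_cast hmk hh)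
  subst hs₂ hs₃ ht₂ ht₃
  have hsmall : ∀ n : ℕ, 0 < n → n < 15 → (n : ZMod m) ≠ 0 := fun n h0 hn hz =>
    absurd (Nat.le_of_dvd h0 ((ZMod.natCast_eq_zero_iff _ _).1 hz)) (by omega)
  have h1 : (1 : ZMod m) ≠ 0 := by exact_mod_cast hsmall 1 (by norm_num) (by norm_num)
  have h2 : (2 : ZMod m) ≠ 0 := by exact_mod_cast hsmall 2 (by norm_num) (by norm_num)
  have hh0 : h ≠ 0 := fun h0 => h1 (by rw [← hh, h0, mul_zero])
  obtain ⟨𝓓X, ⟨hX3, hX3c⟩⟩ := hX3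
  obtain ⟨𝓓X', ⟨hX4, hX4c⟩⟩ := hX4
  obtain ⟨𝓓Y, ⟨hY3, hY3c⟩⟩ := hY3
  obtain ⟨q, hq1, hq2, Q₁, Q₂, Q₃, 𝓒, hQ₁, hQ₂, hQ₃, h₁₂, h₁₃, h₂₃, hCc, hY4⟩ := hY4
  have hX1ne : (1 : ZMod m) ≠ t₁ := fun h0 => hSX hX2.1 (by simp [h0])
  have hX2ne : (1 : ZMod m) ≠ t₁ + h := fun h0 => hX1.1 (by
    have := hX2.1
    rwa [h0, add_sub_cancel_left] at this)
  have hX3ne : t₁ ≠ t₁ + h := fun h0 => hh0 (by simpa using h0)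
  -- At t₁ the forbidden heads are 1 (the arc b₁^X), t₁ itself (no loops) and t₁ + h (used by a
  -- zigzag). The arc of difference -t₁ out of t₁ is c₁, which is available.
  have hfamX := DirectedCycles.exists_hamiltonian_family (𝓓 := 𝓓X ∪ 𝓓X')
    (by rintro H (hH | hH); exacts [hX3c H hH, hX4c H hH]) t₁ {1, t₁, t₁ + h}
    (by
      rintro H (hH | hH) w hw hT
      · obtain ⟨d, hd, hwd⟩ := (hX3.1 H hH).2 _ hw
        simp only at hwd
        simp only [Finset.mem_insert, Finset.mem_singleton] at hT
        rcases hT with rfl | rfl | rfl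
        · exact hd.2 (.inl (by rw [show d = 1 - t₁ by linear_combination -hwd]; exact hX2.1))
        · exact hd.1 (by simpa using hwd)
        · exact hd.2 (.inr (.inl (by linear_combination -hwd)))
      · simp only [Finset.mem_insert, Finset.mem_singleton] at hT
        rcases (hX4.1 H hH).2 _ hw with ⟨⟨d, hd, hwd⟩, hb⟩ | hc
        · simp only at hwd
          rcases hT with rfl | rfl | rfl
          · exact hb (by simp)
          · exact hSX hd (by simpa using hwd)
          · exact hX1.1 (by rwa [show d = h by linear_combination -hwd] at hd)
        · have hw0 : w = 0 := by simpa [h1, h2] using hc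
          subst hw0
          rcases hT with h0 | h0 | h0
          · exact h1 h0.symm
          -- Multiplying 0 = t₁ = -3/8 by 8 gives 3 = 0; in the next case, t₁ + h = 1/8 gives 1 = 0.
          · apply hsmall 3 (by norm_num) (by norm_num)
            rw [ht] at h0
            push_cast
            linear_combination 8 * h0 - 3 * (4 * h ^ 2 + 2 * h + 1) * hh
          · rw [ht] at h0
            exact h1 (by linear_combination -8 * h0 + (12 * h ^ 2 + 6 * h - 1) * hh))
    (fun H hH H' hH' w => hX3.eq_of_mem_union hX4 (by
      rintro w ⟨d, hd, rfl⟩ (⟨⟨d', hd', hw⟩, -⟩ | hc)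
      · exact hd.2 (.inl (by rwa [add_left_cancel hw]))
      · have hw0 : t₁ + d = 0 := by simpa [h1, h2] using hc
        exact hd.2 (.inr (.inr (by simp only [Set.mem_singleton_iff]; linear_combination hw0)))) hH hH')
  have hcardX : ({1, t₁, t₁ + h} : Finset (ZMod m)).card = 3 :=
    Finset.card_eq_three.2 ⟨1, t₁, t₁ + h, hX1ne, hX2ne, hX3ne, rfl⟩
  rw [hcardX] at hfamX
  obtain ⟨cX, hcX, hcovX⟩ := hfamX
  -- The vertex -1 is the tail of b₃^Y, so the forbidden heads are s₃, -1 and -1 + h.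
  have hfamY := DirectedCycles.exists_hamiltonian_family (𝓓 := 𝓓Y ∪ 𝓒)
    (by rintro H (hH | hH); exacts [hY3c H hH, hCc H hH]) (-1) {s₁ + 4, -1, -1 + h}
    (by
      rintro H (hH | hH) w hw hT
      · obtain ⟨d, hd, hwd⟩ := (hY3.1 H hH).2 _ hw
        simp only at hwd
        simp only [Finset.mem_insert, Finset.mem_singleton] at hT
        rcases hT with rfl | rfl | rfl
        · exact hd.2 (.inl (by
            rw [show d = s₁ + 5 by linear_combination -hwd]
            exact hY2.2))
        · exact hd.1 (by simpa using hwd)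
        · exact hd.2 (.inr (by simpa using hwd.symm))
      · simp only [Finset.mem_insert, Finset.mem_singleton] at hT
        obtain ⟨⟨d, hd, hwd⟩, hb⟩ := (hY4.1 H (.inr hH)).2 _ hw
        simp only at hwd
        rcases hT with rfl | rfl | rfl
        · exact hb (by simp)
        · exact hSY hd (by simpa using hwd)
        · exact hY1 (by rwa [show d = h by linear_combination -hwd] at hd))
    (fun H hH H' hH' w => hY3.eq_of_mem_union hY4 (by
      rintro w ⟨d, hd, rfl⟩ ⟨⟨d', hd', hw⟩, -⟩
      exact hd.2 (.inl (by rwa [add_left_cancel hw]))) (hH.imp_right .inr) (hH'.imp_right .inr))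
  have hcardY : ({s₁ + 4, -1, -1 + h} : Finset (ZMod m)).card = 3 := by
    refine Finset.card_eq_three.2 ⟨s₁ + 4, -1, -1 + h, fun h0 => ?_, fun h0 => ?_, fun h0 => ?_, rfl⟩
    · exact hSY hY2.2 (by simp only [Set.mem_singleton_iff]; linear_combination h0)
    · exact hY1 (by rw [show h = s₁ + 5 by linear_combination -h0]; exact hY2.2)
    · exact hh0 (by simpa using h0)
  rw [hcardY] at hfamY
  obtain ⟨cY, hcY, hcovY⟩ := hfamY
  let A : Fin (m - 3) ⊕ ZMod m ⊕ Bool → ZMod m ⊕ ZMod m → ZMod m ⊕ ZMod m → Prop :=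
    Sum.elim (fun f => PureArc (cX f) (cY f)) (Sum.elim (ZigzagArc h)
      fun b => if b then LinkArc M h Q₁ Q₂ Q₃ else MixedArc M h)
  have hpureX : ∀ H ∈ 𝓓X ∪ 𝓓X', ∀ i j, (i, j) ∈ H.arcs → ∃ f, A f (.inl i) (.inl j) := by
    intro H hH i j hij
    obtain ⟨f, n, rfl, rfl⟩ := hcovX H hH i j hij
    exact ⟨.inl f, PureArc.xx n⟩
  have hpureY : ∀ H ∈ 𝓓Y ∪ 𝓒, ∀ i j, (i, j) ∈ H.arcs → ∃ f, A f (.inr i) (.inr j) := by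
    intro H hH i j hij
    obtain ⟨f, n, rfl, rfl⟩ := hcovY H hH i j hij
    exact ⟨.inl f, PureArc.yy n⟩
  have hzig : ∀ {u v} r, ZigzagArc h r u v → ∃ f, A f u v := fun r hr => ⟨.inr (.inl r), hr⟩
  have hlink : ∀ {u v}, LinkArc M h Q₁ Q₂ Q₃ u v → ∃ f, A f u v :=
    fun hr => ⟨.inr (.inr true), hr⟩
  have hmixed : ∀ {u v}, MixedArc M h u v → ∃ f, A f u v := fun hr => ⟨.inr (.inr false), hr⟩
  have hcard : Fintype.card (ZMod m ⊕ ZMod m) = Fintype.card (Fin (2 * m)) := by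
    simp [ZMod.card, two_mul]
  refine DirectedCycles.hasResolvableCycleDecomposition_of_hasTwoCycleFactor
    (Fintype.equivOfCardEq hcard) (by omega) (by simp)
    (by simp only [Fintype.card_sum, Fintype.card_fin, ZMod.card, Fintype.card_bool]; omega)
    A ?_ ?_
  · rintro (f | r | _ | _)
    · exact hasTwoCycleFactor_pureArc (hcX f) (hcY f)
    · exact hasTwoCycleFactor_zigzagArc hm_odd hh r
    · exact hasTwoCycleFactor_mixedArc hM hMo hh
    · rw [hs] at hQ₁ hQ₂ hQ₃
      -- The bound q ≤ m/3 - 3 makes the truncated subtraction m/3 - 2 - q exact.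
      exact hasTwoCycleFactor_linkArc hM hh (by omega) (by omega) hQ₁ hQ₂ hQ₃ h₁₂ h₁₃ h₂₃
  · rintro (i | i) (j | j) hij
    · have hij' : i ≠ j := fun h0 => hij (by rw [h0])
      by_cases hd1 : j - i = h
      · rw [show j = h + i by linear_combination hd1]
        exact hzig i .xx
      by_cases hd2 : j - i = -t₁
      -- Arcs of difference -t₁ either stay inside a helix or close it up; the closing ones are the
      -- c_i, already covered by (X₄).
      · by_cases hc : (i, j) ∈ ({(t₁, 0), (t₁ + 1, 1), (t₁ + 2, 2)} : Set (ZMod m × ZMod m))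
        · obtain ⟨H, ⟨hH, hH'⟩, -⟩ := hX4.2 i j (.inr hc)
          exact hpureX H (.inr hH) i j hH'
        · rcases helix_cases hM hh i with ⟨a, ha, n, hn, rfl⟩ | ⟨a, ha, hp⟩
          · apply hlink
            convert LinkArc.xx (h := h) (Q₁ := Q₁) (Q₂ := Q₂) (Q₃ := Q₃) a n ha hn using 2
            rw [helix_succ]
            linear_combination hd2 - ht
          · refine absurd ?_ hc
            have hj : j = a := by linear_combination hd2 + hp - ht
            have hi : i = t₁ + a := by linear_combination hp - ht
            rw [hi, hj]
            interval_cases a <;> simp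
      by_cases hd3 : j - i ∈ SX
      · by_cases hb : (i, j) ∈ ({(t₁, 1), (t₁ + 1, 2), (t₁ + 2, 0)} : Set (ZMod m × ZMod m))
        · simp only [Set.mem_insert_iff, Set.mem_singleton_iff, Prod.mk.injEq] at hb
          apply hmixed
          rcases hb with ⟨rfl, rfl⟩ | ⟨rfl, rfl⟩ | ⟨rfl, rfl⟩
          · rw [ht]; exact .xx₀
          · rw [show t₁ + 1 = 1 - 3 * h ^ 3 by linear_combination ht]; exact .xx₁
          · rw [show t₁ + 2 = 2 - 3 * h ^ 3 by linear_combination ht]; exact .xx₂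
        · obtain ⟨H, ⟨hH, hH'⟩, -⟩ := hX4.2 i j (.inl ⟨⟨j - i, hd3, by simp⟩, hb⟩)
          exact hpureX H (.inr hH) i j hH'
      · obtain ⟨H, ⟨hH, hH'⟩, -⟩ := hX3.2 i j ⟨j - i, ⟨by simpa [sub_eq_zero] using hij'.symm, by
          rintro (h0 | h0 | h0)
          exacts [hd3 h0, hd1 h0, hd2 h0]⟩, by simp⟩
        exact hpureX H (.inl hH) i j hH'
    · rcases arc_cover_xy hM hh Q₁ Q₂ Q₃ i j with ⟨r, hr⟩ | hr | hr
      exacts [hzig r hr, hlink hr, hmixed hr]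
    · rcases arc_cover_yx hM hh Q₁ Q₂ Q₃ j i with ⟨r, hr⟩ | hr | hr
      exacts [hzig r hr, hlink hr, hmixed hr]
    · have hij' : i ≠ j := fun h0 => hij (by rw [h0])
      by_cases hd1 : j - i = h
      -- The pure y-arc of zigzag r leaves 2r, so r = i/2.
      · apply hzig (h * i)
        convert ZigzagArc.yy (h := h) (r := h * i) using 2
        · linear_combination -i * hh
        · linear_combination hd1 - i * hh
      by_cases hd3 : j - i ∈ SY
      · by_cases hb : (i, j) ∈ ({(1, s₁), (3, s₁ + 2), (-1, s₁ + 4)} : Set (ZMod m × ZMod m))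
        · simp only [Set.mem_insert_iff, Set.mem_singleton_iff, Prod.mk.injEq] at hb
          apply hmixed
          rcases hb with ⟨rfl, rfl⟩ | ⟨rfl, rfl⟩ | ⟨rfl, rfl⟩
          · rw [hs]; exact .yy₂
          · rw [show s₁ + 2 = 2 - h ^ 2 by linear_combination hs]; exact .yy₁
          · rw [show s₁ + 4 = 4 - h ^ 2 by linear_combination hs]; exact .yy₀
        · obtain ⟨H, ⟨hH, hH'⟩, -⟩ := hY4.2 i j ⟨⟨j - i, hd3, by simp⟩, hb⟩
          rcases hH with (rfl | rfl | rfl) | hH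
          · exact hlink (.yy₁ i j hH')
          · exact hlink (.yy₂ i j hH')
          · exact hlink (.yy₃ i j hH')
          · exact hpureY H (.inr hH) i j hH'
      · obtain ⟨H, ⟨hH, hH'⟩, -⟩ := hY3.2 i j ⟨j - i, ⟨by simpa [sub_eq_zero] using hij'.symm, by
          rintro (h0 | h0)
          exacts [hd3 h0, hd1 h0]⟩, by simp⟩
        exact hpureY H (.inl hH) i j hH'
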